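/- For an integer $n\ge 1$ consider the following two-step experiment (Procedure 2). First choose a partition $\lambda$ of $n$ uniformly at random among all $p(n)$ partitions of $n$, and let $\alpha_j^{(n)}$ be the number of parts of $\lambda$ equal to $j$. Then, given $\lambda$, choose a part size $j$ of $\lambda$ with probability proportional to its size times its multiplicity, i.e. with probability $j\alpha_j^{(n)}/n$. Let $\sigma_{n,2}$ be the chosen part size and let $\mathbb{P}$ denote the probability measure of the whole experiment. Then for every real $t$ with $0<t<\infty$ $$\lim_{n\to\infty}\mathbb{P}\left(\frac{\pi\sigma_{n,2}}{\sqrt{6n}}\le t\right)=\frac{6}{\pi^2}\int_0^t\frac{u}{e^u-1}\,du .$$ Moreover, for real $s>0$ let $X_{s,n}=\sum_{1\le j\le s}j\alpha_j^{(n)}$ if $s\le n$ and $X_{s,n}=n$ if $s>n$, and let $\mathbb{E}$ denote expectation with respect to the uniform measure on the partitions of $n$. Then for every fixed $0<t<\infty$, with $s=t\sqrt{6n}/\pi$, $$\mathbb{E}(X_{s,n})\sim\frac{6n}{\pi^2}\int_0^t\frac{u}{e^u-1}\,du\qquad(n\to\infty).$$ -/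

import Mathlib

open scoped ENNReal

namespace PartSampling

noncomputable section

/-- The multiplicity of the part size `j` in the partition `l`. -/
def mult {n : ℕ} (l : n.Partition) (j : ℕ) : ℕ := l.parts.count j

/-- The weight of the part size `j` in `l`: its size times its multiplicity. -/
def weight {n : ℕ} (l : n.Partition) (j : ℕ) : ℕ := j * mult l j

theorem sum_weight {n : ℕ} (l : n.Partition) : ∑ j ∈ Finset.range (n + 1), weight l j = n := by
  have h := Finset.sum_multiset_count_of_subset l.parts (Finset.range (n + 1)) (fun j hj => by
    have := Nat.Partition.le_of_mem_parts (Multiset.mem_toFinset.1 hj)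
    simp only [Finset.mem_range]; omega)
  rw [l.parts_sum] at h
  conv_rhs => rw [h]
  exact Finset.sum_congr rfl fun j _ => by simp [weight, mult, mul_comm]

theorem tsum_weight {n : ℕ} (l : n.Partition) : ∑' j, (weight l j : ℝ≥0∞) = n := by
  rw [tsum_eq_sum (s := Finset.range (n + 1))]
  · exact_mod_cast congrArg (Nat.cast (R := ℝ≥0∞)) (sum_weight l)
  · intro j hj
    have hm : j ∉ l.parts := fun h => hj (by
      have := Nat.Partition.le_of_mem_parts h
      simp only [Finset.mem_range]; omega)
    simp [weight, mult, Multiset.count_eq_zero_of_notMem hm]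

/-- Second step of the procedure: given the partition `l` of `n ≥ 1`, a part size is chosen
with probability proportional to size times multiplicity. -/
def pickPart {n : ℕ} (hn : 0 < n) (l : n.Partition) : PMF ℕ :=
  PMF.normalize (fun j => (weight l j : ℝ≥0∞))
    (by rw [tsum_weight]; exact_mod_cast hn.ne')
    (by rw [tsum_weight]; exact ENNReal.natCast_ne_top n)

/-- The two-step procedure: the joint law of the uniformly random partition of `n` and of the
size of the part picked from it. -/
def procedure {n : ℕ} (hn : 0 < n) : PMF (n.Partition × ℕ) :=
  (PMF.uniformOfFintype n.Partition).bind fun l => (pickPart hn l).map fun j => (l, j)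

/-- The law of the size `σ` of the picked part. -/
def sizeLaw {n : ℕ} (hn : 0 < n) : PMF ℕ := (procedure hn).map Prod.snd

/-- The sum of all parts (with multiplicity) of size at most `s`, and `n` if `s > n`. -/
def X {n : ℕ} (s : ℝ) (l : n.Partition) : ℝ :=
  if s ≤ n then ∑ j ∈ Finset.Icc 1 ⌊s⌋₊, (j : ℝ) * (mult l j : ℝ) else n

/-- The expectation of `X s` over a uniformly random partition of `n`. -/
def expX (s : ℝ) (n : ℕ) : ℝ :=
  (∑ l : n.Partition, X s l) / (Fintype.card n.Partition : ℝ)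

end

end PartSampling

namespace PartSampling

open Filter Topology

/-! Given the partition, the picked size is at most `s` with probability `X s l / n`, so both claims
are the single limit of `expX s n / n`. That limit follows from a convexity argument, with no
precise asymptotics of p(n). Put d = π/√(6n). By Jensen, θ d E(X) is at most the logarithm of the
mean of exp(θ d X). An Euler product in which only the parts up to `s` are tilted bounds this by d n
+ `logGen d` - log p(n) plus θ times a Riemann sum (`sum_exp_X_le`, `mul_expX_le`). For this d,
`logGen d` ≤ d n, while log p(n) ≥ (2 - 3θ²) d n for large n (`eventually_log_card_partition_ge`),
so the terms free of θ cancel up to 3θ² d n. After division by θ d n the error is O(θ): positive θ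
bounds the limit superior, negative θ the limit inferior, and θ → 0 closes the gap
(`tendsto_expX_div`). The lower bound on log p(n) uses the generating function at a point slightly
beyond the saddle: its mass lies just below n, where monotonicity of p replaces a Tauberian theorem.
-/

/-! ### Partitions as multiplicity vectors, and finite Euler products. -/

theorem sum_le_sum_of_injOn {ι κ : Type*} {S : Finset ι} {T : Finset κ} {f : ι → ℝ} {g : κ → ℝ}
    (e : ι → κ) (he : ∀ i ∈ S, e i ∈ T) (hinj : Set.InjOn e S) (hfg : ∀ i ∈ S, f i = g (e i))
    (hg : ∀ k ∈ T, 0 ≤ g k) : ∑ i ∈ S, f i ≤ ∑ k ∈ T, g k := by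
  classical
  rw [Finset.sum_congr rfl hfg, ← Finset.sum_image (f := g) hinj]
  refine Finset.sum_le_sum_of_subset_of_nonneg ?_ fun k hk _ => hg k hk
  intro k hk
  obtain ⟨i, hi, rfl⟩ := Finset.mem_image.1 hk
  exact he i hi

/-- The multiset with `f i` copies of `i + 1`. -/
def ofMult {N : ℕ} (f : Fin N → ℕ) : Multiset ℕ := ∑ i, f i • {(i : ℕ) + 1}

theorem count_ofMult {N : ℕ} (f : Fin N → ℕ) (i : Fin N) :
    (ofMult f).count ((i : ℕ) + 1) = f i := by
  rw [ofMult, Multiset.count_sum', Finset.sum_eq_single i]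
  · simp
  · intro b _ hb
    rw [Multiset.count_nsmul, Multiset.count_singleton, if_neg, mul_zero]
    intro h
    exact hb (Fin.ext (by omega))
  · simp

theorem mem_ofMult {N : ℕ} {f : Fin N → ℕ} {j : ℕ} (hj : j ∈ ofMult f) :
    ∃ i : Fin N, j = (i : ℕ) + 1 := by
  obtain ⟨i, -, hi⟩ := Multiset.mem_sum.1 hj
  exact ⟨i, by simpa using Multiset.mem_of_mem_nsmul hi⟩

theorem ofMult_count {N : ℕ} {l : Multiset ℕ} (hl : ∀ j ∈ l, 0 < j ∧ j ≤ N) :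
    ofMult (fun i : Fin N => l.count ((i : ℕ) + 1)) = l := by
  ext j
  by_cases hj : 0 < j ∧ j ≤ N
  · have h := count_ofMult (fun i : Fin N => l.count ((i : ℕ) + 1)) ⟨j - 1, by omega⟩
    have e : j - 1 + 1 = j := by omega
    simpa only [e] using h
  · rw [Multiset.count_eq_zero_of_notMem, Multiset.count_eq_zero_of_notMem fun h => hj (hl j h)]
    intro h
    obtain ⟨i, rfl⟩ := mem_ofMult h
    exact hj ⟨by omega, by omega⟩

theorem prod_map_ofMult {N : ℕ} (f : Fin N → ℕ) (x : ℕ → ℝ) :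
    ((ofMult f).map x).prod = ∏ i : Fin N, x ((i : ℕ) + 1) ^ f i := by
  rw [ofMult, ← Multiset.coe_mapAddMonoidHom, map_sum, Multiset.prod_sum]
  refine Finset.prod_congr rfl fun i _ => ?_
  rw [map_nsmul, Multiset.prod_nsmul]
  simp

theorem sum_ofMult {N : ℕ} (f : Fin N → ℕ) : (ofMult f).sum = ∑ i : Fin N, f i * ((i : ℕ) + 1) := by
  rw [ofMult, Multiset.sum_sum]
  exact Finset.sum_congr rfl fun i _ => by rw [Multiset.sum_nsmul]; simp

theorem prod_map_nonneg {x : ℕ → ℝ} (hx : ∀ j, 0 ≤ x j) (l : Multiset ℕ) : 0 ≤ (l.map x).prod := by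
  refine Multiset.prod_nonneg fun a ha => ?_
  obtain ⟨j, -, rfl⟩ := Multiset.mem_map.1 ha
  exact hx j

/-- The total weight of the partitions of numbers up to `N` is at most the Euler product. -/
theorem sum_prod_parts_le {x : ℕ → ℝ} (hx0 : ∀ j, 0 ≤ x j) (hx1 : ∀ j, 0 < j → x j < 1) (N : ℕ) :
    ∑ m ∈ Finset.range (N + 1), ∑ l : m.Partition, (l.parts.map x).prod ≤
      ∏ i ∈ Finset.range N, (1 - x (i + 1))⁻¹ := by
  rw [Finset.sum_sigma']
  calc _ ≤ ∑ f ∈ Fintype.piFinset fun _ : Fin N => Finset.range (N + 1),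
        ∏ i : Fin N, x ((i : ℕ) + 1) ^ f i := by
        have key : ∀ z ∈ (Finset.range (N + 1)).sigma
            fun m => (Finset.univ : Finset m.Partition),
            ofMult (fun i : Fin N => z.2.parts.count ((i : ℕ) + 1)) = z.2.parts := by
          rintro ⟨m, l⟩ hz
          have hm : m < N + 1 := by simpa using hz
          refine ofMult_count fun j hj => ⟨l.parts_pos hj, ?_⟩
          have : j ≤ m := Nat.Partition.le_of_mem_parts hj
          omega
        refine sum_le_sum_of_injOn (fun z i => z.2.parts.count ((i : ℕ) + 1)) ?_ ?_ ?_ ?_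
        · rintro ⟨m, l⟩ hz
          have hm : m < N + 1 := by simpa using hz
          refine Fintype.mem_piFinset.2 fun i => Finset.mem_range.2 ?_
          have h1 : l.parts.count ((i : ℕ) + 1) ≤ m := by
            have h := Multiset.card_nsmul_le_sum (s := l.parts) (a := 1) fun j hj => l.parts_pos hj
            rw [l.parts_sum, smul_eq_mul, mul_one] at h
            exact (Multiset.count_le_card _ _).trans h
          simp only
          omega
        · rintro ⟨m, l⟩ hz ⟨m', l'⟩ hz' h
          have h1 := key _ hz
          have h2 := key _ hz'
          have h3 : l.parts = l'.parts := by
            rw [← h1, ← h2]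
            exact congrArg ofMult h
          have hm : m = m' := by rw [← l.parts_sum, ← l'.parts_sum, h3]
          subst hm
          rw [Nat.Partition.ext h3]
        · intro z hz
          rw [← prod_map_ofMult, key z hz]
        · exact fun f _ => Finset.prod_nonneg fun i _ => pow_nonneg (hx0 _) _
    _ = ∏ i : Fin N, ∑ a ∈ Finset.range (N + 1), x ((i : ℕ) + 1) ^ a :=
        (Finset.prod_univ_sum (fun _ : Fin N => Finset.range (N + 1))
          fun i a => x ((i : ℕ) + 1) ^ a).symm
    _ ≤ ∏ i : Fin N, (1 - x ((i : ℕ) + 1))⁻¹ := by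
        refine Finset.prod_le_prod (fun i _ => Finset.sum_nonneg fun a _ => pow_nonneg (hx0 _) _)
          fun i _ => ?_
        have hs := hasSum_geometric_of_lt_one (hx0 ((i : ℕ) + 1)) (hx1 _ i.1.succ_pos)
        exact sum_le_hasSum _ (fun a _ => pow_nonneg (hx0 _) _) hs
    _ = _ := (Finset.prod_range fun i => (1 - x (i + 1))⁻¹).symm

/-- Products of truncated geometric series are dominated by sums over partitions. -/
theorem exists_prod_geom_le_sum {x : ℕ → ℝ} (hx0 : ∀ j, 0 ≤ x j) (N A : ℕ) :
    ∃ M : ℕ, ∏ i ∈ Finset.range N, ∑ a ∈ Finset.range A, x (i + 1) ^ a ≤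
      ∑ m ∈ Finset.range M, ∑ l : m.Partition, (l.parts.map x).prod := by
  -- Fewer than `A` copies of each part 1, ..., N keep the partitioned number below this bound.
  refine ⟨(∑ i : Fin N, A * ((i : ℕ) + 1)) + 1, ?_⟩
  rw [Finset.prod_range fun i => ∑ a ∈ Finset.range A, x (i + 1) ^ a,
    Finset.prod_univ_sum (fun _ : Fin N => Finset.range A) fun i a => x ((i : ℕ) + 1) ^ a,
    Finset.sum_sigma']
  let e : (Fin N → ℕ) → Σ m : ℕ, m.Partition := fun f =>
    ⟨(ofMult f).sum, ofMult f, fun {j} hj => by obtain ⟨i, rfl⟩ := mem_ofMult hj; omega, rfl⟩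
  refine sum_le_sum_of_injOn e ?_ ?_ ?_ ?_
  · intro f hf
    simp only [Finset.mem_sigma, Finset.mem_range, Finset.mem_univ, and_true, e]
    rw [sum_ofMult, Nat.lt_succ_iff]
    refine Finset.sum_le_sum fun i _ => Nat.mul_le_mul_right _ ?_
    exact (Finset.mem_range.1 (Fintype.mem_piFinset.1 hf i)).le
  · intro f _ g _ h
    have h' : ofMult f = ofMult g := congrArg (fun z : Σ m : ℕ, m.Partition => z.2.parts) h
    funext i
    rw [← count_ofMult f i, h', count_ofMult]
  · intro f _
    exact (prod_map_ofMult f x).symm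
  · exact fun z _ => prod_map_nonneg hx0 _

theorem card_partition_mono : Monotone fun n : ℕ => Fintype.card n.Partition := by
  refine monotone_nat_of_le_succ fun n => ?_
  -- Adjoining a part 1 injects partitions of n into those of n + 1.
  refine Fintype.card_le_of_injective (fun l : n.Partition => (⟨1 ::ₘ l.parts, ?_, ?_⟩ :
    (n + 1).Partition)) ?_
  · intro i hi
    rcases Multiset.mem_cons.1 hi with rfl | hi
    · exact one_pos
    · exact l.parts_pos hi
  · rw [Multiset.sum_cons, l.parts_sum, add_comm]
  · intro l l' h
    have := congrArg Nat.Partition.parts h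
    exact Nat.Partition.ext ((Multiset.cons_inj_right 1).1 this)

theorem prod_map_exp (h : ℕ → ℝ) (l : Multiset ℕ) :
    (l.map fun j => Real.exp (h j)).prod = Real.exp (l.map h).sum := by
  rw [Real.exp_multiset_sum, Multiset.map_map]; rfl

/-! ### The generating function of p(n) and its behaviour as d → 0. -/

/-- The logarithm of the partition generating function at `exp (-d)`. -/
noncomputable def logGen (d : ℝ) : ℝ :=
  ∑' k : ℕ, 1 / (((k : ℝ) + 1) * (Real.exp (((k : ℝ) + 1) * d) - 1))

theorem exp_sub_one_pos {u : ℝ} (hu : 0 < u) : 0 < Real.exp u - 1 := by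
  have := Real.add_one_lt_exp hu.ne'
  linarith

theorem logGen_term_nonneg {d : ℝ} (hd : 0 < d) (k : ℕ) :
    0 ≤ 1 / (((k : ℝ) + 1) * (Real.exp (((k : ℝ) + 1) * d) - 1)) := by
  have h := exp_sub_one_pos (u := ((k : ℝ) + 1) * d) (by positivity)
  positivity

theorem logGen_term_le {d : ℝ} (hd : 0 < d) (k : ℕ) :
    1 / (((k : ℝ) + 1) * (Real.exp (((k : ℝ) + 1) * d) - 1)) ≤ 1 / ((k : ℝ) + 1) ^ 2 * d⁻¹ := by
  have h := Real.add_one_le_exp (((k : ℝ) + 1) * d)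
  have : ((k : ℝ) + 1) * (((k : ℝ) + 1) * d) ≤
      ((k : ℝ) + 1) * (Real.exp (((k : ℝ) + 1) * d) - 1) := by gcongr; linarith
  calc _ ≤ 1 / (((k : ℝ) + 1) * (((k : ℝ) + 1) * d)) :=
        one_div_le_one_div_of_le (by positivity) this
    _ = _ := by field_simp

theorem hasSum_succ_sq : HasSum (fun k : ℕ => 1 / ((k : ℝ) + 1) ^ 2) (Real.pi ^ 2 / 6) := by
  have h := (hasSum_nat_add_iff' 1).2 hasSum_zeta_two
  simpa using h

theorem summable_logGen {d : ℝ} (hd : 0 < d) :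
    Summable fun k : ℕ => 1 / (((k : ℝ) + 1) * (Real.exp (((k : ℝ) + 1) * d) - 1)) :=
  Summable.of_nonneg_of_le (logGen_term_nonneg hd) (logGen_term_le hd)
    (hasSum_succ_sq.summable.mul_right _)

theorem logGen_le {d : ℝ} (hd : 0 < d) : logGen d ≤ Real.pi ^ 2 / 6 / d := by
  rw [div_eq_mul_inv (Real.pi ^ 2 / 6)]
  exact hasSum_le (logGen_term_le hd) (summable_logGen hd).hasSum (hasSum_succ_sq.mul_right _)

/-- Since (e^{kd} - 1)/d → k, the k-th term times d tends to 1/k², and 1/k² also dominates it; the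
limit is ζ(2). -/
theorem tendsto_mul_logGen :
    Tendsto (fun d => d * logGen d) (𝓝[>] 0) (𝓝 (Real.pi ^ 2 / 6)) := by
  rw [← hasSum_succ_sq.tsum_eq]
  have e : (fun d => ∑' k : ℕ, d * (1 / (((k : ℝ) + 1) * (Real.exp (((k : ℝ) + 1) * d) - 1))))
      = fun d => d * logGen d := by
    funext d
    rw [tsum_mul_left, logGen]
  rw [← e]
  refine tendsto_tsum_of_dominated_convergence hasSum_succ_sq.summable (fun k => ?_) ?_
  · have hk : (0 : ℝ) < (k : ℝ) + 1 := by positivity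
    have hder : HasDerivAt (fun d : ℝ => Real.exp (((k : ℝ) + 1) * d)) ((k : ℝ) + 1) 0 := by
      have := ((hasDerivAt_id (0 : ℝ)).const_mul ((k : ℝ) + 1)).exp
      simpa using this
    have h1 : Tendsto (fun d : ℝ => d⁻¹ * (Real.exp (((k : ℝ) + 1) * d) - 1)) (𝓝[>] 0)
        (𝓝 ((k : ℝ) + 1)) := by
      have := hder.tendsto_slope_zero_right
      simpa using this
    have h2 := ((h1.const_mul ((k : ℝ) + 1)).inv₀ (by positivity))
    refine (h2.congr' ?_).trans (le_of_eq (by congr 1; field_simp))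
    filter_upwards [self_mem_nhdsWithin] with d hd
    have hd : 0 < d := hd
    have := exp_sub_one_pos (u := ((k : ℝ) + 1) * d) (by positivity)
    field_simp
  · filter_upwards [self_mem_nhdsWithin] with d hd k
    have hd : 0 < d := hd
    rw [Real.norm_of_nonneg (mul_nonneg hd.le (logGen_term_nonneg hd k))]
    calc _ ≤ d * (1 / ((k : ℝ) + 1) ^ 2 * d⁻¹) :=
          mul_le_mul_of_nonneg_left (logGen_term_le hd k) hd.le
      _ = _ := by field_simp

theorem hasSum_of_nonneg_of_rows {f : ℕ × ℕ → ℝ} {g h : ℕ → ℝ} (hf : 0 ≤ f)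
    (hrow : ∀ k, HasSum (fun j => f (k, j)) (g k)) (hg : Summable g)
    (hcol : ∀ j, HasSum (fun k => f (k, j)) (h j)) : HasSum h (∑' k, g k) := by
  have hsum : Summable f := by
    refine (summable_prod_of_nonneg hf).2 ⟨fun k => (hrow k).summable, ?_⟩
    simpa only [(hrow _).tsum_eq] using hg
  have e : ∑' k, g k = ∑' z, f z := (hsum.hasSum.prod_fiberwise hrow).tsum_eq
  have hswap : HasSum (fun z : ℕ × ℕ => f (z.2, z.1)) (∑' k, g k) := by
    rw [e]
    exact (Equiv.prodComm ℕ ℕ).hasSum_iff.2 hsum.hasSum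
  exact HasSum.prod_fiberwise hswap hcol

/-- Expand -log(1 - x) = ∑ x^k/k and interchange the nonnegative double sum; for fixed k the sum
over j is geometric. -/
theorem hasSum_neg_log {d : ℝ} (hd : 0 < d) :
    HasSum (fun j : ℕ => -Real.log (1 - Real.exp (-d * ((j : ℝ) + 1)))) (logGen d) := by
  let f : ℕ × ℕ → ℝ := fun z =>
    Real.exp (-d * ((z.2 : ℝ) + 1)) ^ (z.1 + 1) / ((z.1 : ℝ) + 1)
  have hf : 0 ≤ f := fun z => by simp only [f, Pi.zero_apply]; positivity
  have hrow : ∀ k : ℕ, HasSum (fun j : ℕ => f (k, j))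
      (1 / (((k : ℝ) + 1) * (Real.exp (((k : ℝ) + 1) * d) - 1))) := by
    intro k
    have hu : 0 < ((k : ℝ) + 1) * d := by positivity
    have h1 : Real.exp (-(((k : ℝ) + 1) * d)) < 1 := Real.exp_lt_one_iff.2 (by linarith)
    have hg := (hasSum_geometric_of_lt_one (Real.exp_pos _).le h1).mul_left
      (Real.exp (-(((k : ℝ) + 1) * d)) / ((k : ℝ) + 1))
    convert! hg using 1
    · funext j
      simp only [f]
      rw [div_mul_eq_mul_div, ← Real.exp_nat_mul, ← Real.exp_nat_mul, ← Real.exp_add]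
      congr 2
      push_cast
      ring
    · have h2 := exp_sub_one_pos hu
      have h3 : 1 - Real.exp (-(((k : ℝ) + 1) * d)) ≠ 0 := by linarith
      rw [Real.exp_neg] at h3 ⊢
      have h4 := Real.exp_pos (((k : ℝ) + 1) * d)
      have h5 : 1 - (Real.exp (((k : ℝ) + 1) * d))⁻¹ =
        (Real.exp (((k : ℝ) + 1) * d) - 1) / Real.exp (((k : ℝ) + 1) * d) := by field_simp
      rw [h5]
      field_simp
  have hcol : ∀ j : ℕ, HasSum (fun k : ℕ => f (k, j))
      (-Real.log (1 - Real.exp (-d * ((j : ℝ) + 1)))) := by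
    intro j
    simp only [f]
    refine Real.hasSum_pow_div_log_of_abs_lt_one (x := Real.exp (-d * ((j : ℝ) + 1))) ?_
    rw [abs_of_pos (Real.exp_pos _)]
    refine Real.exp_lt_one_iff.2 ?_
    have : 0 < d * ((j : ℝ) + 1) := by positivity
    linarith
  exact hasSum_of_nonneg_of_rows hf hrow (summable_logGen hd) hcol

/-- The generating function of the partition numbers on the unit interval. -/
theorem hasSum_card_partition {d : ℝ} (hd : 0 < d) :
    HasSum (fun m : ℕ => (Fintype.card m.Partition : ℝ) * Real.exp (-d * m))
      (Real.exp (logGen d)) := by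
  have hx0 : ∀ j : ℕ, 0 ≤ Real.exp (-d * j) := fun j => (Real.exp_pos _).le
  have hx1 : ∀ j : ℕ, 0 < j → Real.exp (-d * j) < 1 := fun j hj => by
    refine Real.exp_lt_one_iff.2 ?_
    have : 0 < d * (j : ℝ) := by positivity
    linarith
  have hterm : ∀ m : ℕ, ∑ l : m.Partition, (l.parts.map fun j : ℕ => Real.exp (-d * j)).prod =
      (Fintype.card m.Partition : ℝ) * Real.exp (-d * m) := by
    intro m
    rw [Finset.sum_congr rfl fun l _ => ?_, Finset.sum_const, nsmul_eq_mul, Finset.card_univ]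
    rw [prod_map_exp, Multiset.sum_map_mul_left, ← Nat.cast_multiset_sum, l.parts_sum]
  have hnn : ∀ m : ℕ, 0 ≤ (Fintype.card m.Partition : ℝ) * Real.exp (-d * m) :=
    fun m => by positivity
  have hprod : ∀ N : ℕ, ∏ i ∈ Finset.range N, (1 - Real.exp (-d * ((i + 1 : ℕ) : ℝ)))⁻¹ =
      Real.exp (∑ i ∈ Finset.range N, -Real.log (1 - Real.exp (-d * ((i : ℝ) + 1)))) := by
    intro N
    rw [Real.exp_sum]
    refine Finset.prod_congr rfl fun i _ => ?_
    have := hx1 (i + 1) i.succ_pos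
    push_cast at this ⊢
    rw [Real.exp_neg, Real.exp_log (by linarith)]
  have hlim := hasSum_neg_log hd
  have hlnn : ∀ j : ℕ, 0 ≤ -Real.log (1 - Real.exp (-d * ((j : ℝ) + 1))) := by
    intro j
    have := hx1 (j + 1) j.succ_pos
    push_cast at this
    have h2 := Real.exp_pos (-d * ((j : ℝ) + 1))
    have := Real.log_nonpos (x := 1 - Real.exp (-d * ((j : ℝ) + 1))) (by linarith) (by linarith)
    linarith
  have hupper : ∀ N : ℕ, ∑ m ∈ Finset.range N, (Fintype.card m.Partition : ℝ) * Real.exp (-d * m) ≤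
      Real.exp (logGen d) := by
    intro N
    calc _ ≤ ∑ m ∈ Finset.range (N + 1), (Fintype.card m.Partition : ℝ) * Real.exp (-d * m) :=
          Finset.sum_le_sum_of_subset_of_nonneg (Finset.range_mono N.le_succ) fun m _ _ => hnn m
      _ ≤ ∏ i ∈ Finset.range N, (1 - Real.exp (-d * ((i + 1 : ℕ) : ℝ)))⁻¹ := by
          rw [← Finset.sum_congr rfl fun m _ => hterm m]
          exact sum_prod_parts_le hx0 hx1 N
      _ ≤ _ := by
          rw [hprod, Real.exp_le_exp]
          exact sum_le_hasSum _ (fun j _ => hlnn j) hlim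
  have hs : Summable fun m : ℕ => (Fintype.card m.Partition : ℝ) * Real.exp (-d * m) :=
    summable_of_sum_range_le hnn hupper
  -- Two limits: the truncation `A` of the geometric series goes to infinity for fixed `N`, then `N`
  -- does.
  have hle : Real.exp (logGen d) ≤ ∑' m : ℕ, (Fintype.card m.Partition : ℝ) * Real.exp (-d * m) := by
    refine le_of_tendsto ((Real.continuous_exp.tendsto _).comp hlim.tendsto_sum_nat)
      (Eventually.of_forall fun N => ?_)
    simp only [Function.comp]
    rw [← hprod]
    refine le_of_tendsto (f := fun A => ∏ i ∈ Finset.range N, ∑ a ∈ Finset.range A,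
      Real.exp (-d * ((i + 1 : ℕ) : ℝ)) ^ a) (x := atTop)
      (tendsto_finsetProd _ fun i _ =>
        (hasSum_geometric_of_lt_one (hx0 _) (hx1 _ i.succ_pos)).tendsto_sum_nat)
      (Eventually.of_forall fun A => ?_)
    obtain ⟨M, hM⟩ := exists_prod_geom_le_sum hx0 N A
    rw [Finset.sum_congr rfl fun m _ => hterm m] at hM
    exact hM.trans (hs.sum_le_tsum _ fun m _ => hnn m)
  have := le_antisymm (hs.tsum_le_of_sum_range_le hupper) hle
  rw [← this]
  exact hs.hasSum

/-! ### Lower bound for log p(n). -/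

/-- Chernoff bounds for both tails of the generating function of the partition numbers,
combined with the monotonicity of these numbers. -/
theorem exp_logGen_le {d τ a : ℝ} (hd : 0 < d) (hτ0 : 0 < τ) (hτ1 : τ < 1) (n : ℕ) :
    Real.exp (logGen d) ≤ Real.exp (-(τ * d * n)) * Real.exp (logGen ((1 - τ) * d)) +
      Real.exp (τ * d * a) * Real.exp (logGen ((1 + τ) * d)) +
      ((n : ℝ) + 1) * (Fintype.card n.Partition * Real.exp (-(d * a))) := by
  have h1 := (hasSum_card_partition (d := (1 - τ) * d) (mul_pos (by linarith) hd)).mul_left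
    (Real.exp (-(τ * d * n)))
  have h2 := (hasSum_card_partition (d := (1 + τ) * d) (by positivity)).mul_left
    (Real.exp (τ * d * a))
  -- The majorant of the window a ≤ m ≤ n, written as a series so that the three majorants can be
  -- compared termwise; it is spread over all n + 1 indices m ≤ n.
  have h3 : HasSum (fun m : ℕ => if m ∈ Finset.range (n + 1) then
      (Fintype.card n.Partition * Real.exp (-(d * a)) : ℝ) else 0)
      (((n : ℝ) + 1) * (Fintype.card n.Partition * Real.exp (-(d * a)))) := by
    have h := hasSum_sum_of_ne_finset_zero (L := SummationFilter.unconditional ℕ) (s := Finset.range (n + 1)) (f := fun m : ℕ =>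
      if m ∈ Finset.range (n + 1) then
      (Fintype.card n.Partition * Real.exp (-(d * a)) : ℝ) else 0) (fun m hm => if_neg hm)
    rw [Finset.sum_congr rfl fun m hm => if_pos hm, Finset.sum_const, Finset.card_range,
      nsmul_eq_mul] at h
    exact_mod_cast h
  refine hasSum_le (fun m => ?_) (hasSum_card_partition hd) ((h1.add h2).add h3)
  have hp : (0 : ℝ) ≤ Fintype.card m.Partition := by positivity
  have e1 : Real.exp (-(τ * d * n)) * ((Fintype.card m.Partition : ℝ) *
      Real.exp (-((1 - τ) * d) * m)) =
      (Fintype.card m.Partition : ℝ) * Real.exp (-(τ * d * n) + -((1 - τ) * d) * m) := by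
    rw [Real.exp_add]; ring
  have e2 : Real.exp (τ * d * a) * ((Fintype.card m.Partition : ℝ) *
      Real.exp (-((1 + τ) * d) * m)) =
      (Fintype.card m.Partition : ℝ) * Real.exp (τ * d * a + -((1 + τ) * d) * m) := by
    rw [Real.exp_add]; ring
  have h0 : (0 : ℝ) ≤ if m ∈ Finset.range (n + 1) then
      (Fintype.card n.Partition * Real.exp (-(d * a)) : ℝ) else 0 := by
    split_ifs <;> positivity
  have hτd : 0 < τ * d := mul_pos hτ0 hd
  rw [e1, e2]
  rcases lt_or_ge n m with hnm | hmn
  · have hnm' : (n : ℝ) ≤ m := by exact_mod_cast hnm.le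
    have : Real.exp (-d * m) ≤ Real.exp (-(τ * d * n) + -((1 - τ) * d) * m) := by
      rw [Real.exp_le_exp]
      have := mul_le_mul_of_nonneg_left hnm' hτd.le
      linarith
    have h4 := mul_le_mul_of_nonneg_left this hp
    have h5 : (0 : ℝ) ≤ (Fintype.card m.Partition : ℝ) *
      Real.exp (τ * d * a + -((1 + τ) * d) * m) := by positivity
    linarith
  · rcases le_total (m : ℝ) a with hma | ham
    · have : Real.exp (-d * m) ≤ Real.exp (τ * d * a + -((1 + τ) * d) * m) := by
        rw [Real.exp_le_exp]
        have := mul_le_mul_of_nonneg_left hma hτd.le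
        linarith
      have h4 := mul_le_mul_of_nonneg_left this hp
      have h5 : (0 : ℝ) ≤ (Fintype.card m.Partition : ℝ) *
        Real.exp (-(τ * d * n) + -((1 - τ) * d) * m) := by positivity
      linarith
    · rw [if_pos (Finset.mem_range.2 (by omega))]
      have h4 : (Fintype.card m.Partition : ℝ) * Real.exp (-d * m) ≤
          Fintype.card n.Partition * Real.exp (-(d * a)) := by
        gcongr
        · exact card_partition_mono hmn
        · have := mul_le_mul_of_nonneg_left ham hd.le
          linarith
      have h5 : (0 : ℝ) ≤ (Fintype.card m.Partition : ℝ) *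
        Real.exp (-(τ * d * n) + -((1 - τ) * d) * m) := by positivity
      have h6 : (0 : ℝ) ≤ (Fintype.card m.Partition : ℝ) *
        Real.exp (τ * d * a + -((1 + τ) * d) * m) := by positivity
      linarith

theorem card_partition_pos (n : ℕ) : (0 : ℝ) < Fintype.card n.Partition := by
  exact_mod_cast Fintype.card_pos

/-- The mass of the generating function sits near m = A/d = n/(1 + η), inside the window from (1 -
η)A/d to n. With τ = η/4 both Chernoff tails are at most exp((1 - η²/8)A). By `hG` and `hbig` each
is at most a quarter of the total, so the window carries at least half of it. -/
theorem log_card_partition_ge_of_logGen {η d A : ℝ} {n : ℕ} (hη0 : 0 < η) (hη1 : η < 1)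
    (hd : 0 < d) (hA : A = Real.pi ^ 2 / 6 / d) (hn : d * n = (1 + η) * A)
    (hG : (1 - η ^ 2 / 16) * A ≤ logGen d) (hbig : Real.log 4 ≤ η ^ 2 / 16 * A) :
    (2 - η - η ^ 2 / 16) * A - Real.log (2 * ((n : ℝ) + 1)) ≤
      Real.log (Fintype.card n.Partition) := by
  have hA0 : 0 < A := by rw [hA]; positivity
  have h := exp_logGen_le (a := (1 - η) * A / d) hd (τ := η / 4) (by linarith) (by linarith) n
  have hp := card_partition_pos n
  have b1 : Real.exp (-(η / 4 * d * n)) * Real.exp (logGen ((1 - η / 4) * d)) ≤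
      Real.exp ((1 - η ^ 2 / 8) * A) := by
    rw [← Real.exp_add, Real.exp_le_exp]
    have h1 := logGen_le (d := (1 - η / 4) * d) (mul_pos (by linarith) hd)
    have h2 : Real.pi ^ 2 / 6 / ((1 - η / 4) * d) = A * (1 - η / 4)⁻¹ := by
      rw [hA]
      have : 1 - η / 4 ≠ 0 := by linarith
      field_simp
    have h3 : (1 - η / 4)⁻¹ ≤ 1 + η / 4 + η ^ 2 / 8 := by
      rw [inv_le_iff_one_le_mul₀ (by linarith)]
      nlinarith [pow_pos hη0 2]
    have h4 := mul_le_mul_of_nonneg_left h3 hA0.le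
    have h5 : η / 4 * d * n = η / 4 * ((1 + η) * A) := by rw [← hn]; ring
    rw [h5]
    rw [h2] at h1
    nlinarith
  have b2 : Real.exp (η / 4 * d * ((1 - η) * A / d)) * Real.exp (logGen ((1 + η / 4) * d)) ≤
      Real.exp ((1 - η ^ 2 / 8) * A) := by
    rw [← Real.exp_add, Real.exp_le_exp]
    have h1 := logGen_le (d := (1 + η / 4) * d) (by positivity)
    have h2 : Real.pi ^ 2 / 6 / ((1 + η / 4) * d) = A * (1 + η / 4)⁻¹ := by
      rw [hA]; field_simp
    have h3 : (1 + η / 4)⁻¹ ≤ 1 - η / 4 + η ^ 2 / 8 := by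
      rw [inv_le_iff_one_le_mul₀ (by linarith)]
      nlinarith [pow_pos hη0 2, pow_pos hη0 3]
    have h4 := mul_le_mul_of_nonneg_left h3 hA0.le
    have h5 : η / 4 * d * ((1 - η) * A / d) = η / 4 * ((1 - η) * A) := by field_simp
    rw [h5]
    rw [h2] at h1
    nlinarith
  have b3 : 4 * Real.exp ((1 - η ^ 2 / 8) * A) ≤ Real.exp ((1 - η ^ 2 / 16) * A) := by
    calc _ = Real.exp (Real.log 4 + (1 - η ^ 2 / 8) * A) := by
          rw [Real.exp_add, Real.exp_log (by norm_num)]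
      _ ≤ _ := by rw [Real.exp_le_exp]; linarith
  have b4 := Real.exp_le_exp.2 hG
  have e : d * ((1 - η) * A / d) = (1 - η) * A := by field_simp
  rw [e] at h
  have h6 : Real.exp ((1 - η ^ 2 / 16) * A) ≤ 2 * ((n : ℝ) + 1) *
      (Fintype.card n.Partition * Real.exp (-((1 - η) * A))) := by linarith
  have h7 := Real.log_le_log (Real.exp_pos _) h6
  rw [Real.log_exp, Real.log_mul (by positivity) (by positivity),
    Real.log_mul hp.ne' (Real.exp_pos _).ne', Real.log_exp] at h7
  linarith

/-- The lower half of the leading-order asymptotics of the logarithm of the partition numbers. -/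
theorem eventually_log_card_partition_ge {η : ℝ} (hη0 : 0 < η) (hη1 : η < 1) :
    ∀ᶠ n : ℕ in atTop, (2 - 3 * η) * (Real.pi / Real.sqrt 6 * Real.sqrt n) ≤
      Real.log (Fintype.card n.Partition) := by
  set c : ℝ := Real.pi / Real.sqrt 6 with hc
  have hc0 : 0 < c := by positivity
  have hc2 : c ^ 2 = Real.pi ^ 2 / 6 := by
    rw [hc, div_pow, Real.sq_sqrt (by norm_num)]
  -- Taking d = c s/√n gives A = c√n/s and d n = s²A = (1 + η)A.
  set s : ℝ := Real.sqrt (1 + η) with hs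
  have hs0 : 0 < s := Real.sqrt_pos.2 (by linarith)
  have hs2 : s ^ 2 = 1 + η := Real.sq_sqrt (by linarith)
  have hsqrt : Tendsto (fun n : ℕ => Real.sqrt n) atTop atTop :=
    Real.tendsto_sqrt_atTop.comp tendsto_natCast_atTop_atTop
  have hd : Tendsto (fun n : ℕ => c * s / Real.sqrt n) atTop (𝓝[>] 0) := by
    refine tendsto_nhdsWithin_iff.2 ⟨hsqrt.const_div_atTop _, ?_⟩
    filter_upwards [eventually_gt_atTop 0] with n hn
    have : 0 < Real.sqrt n := Real.sqrt_pos.2 (by exact_mod_cast hn)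
    exact div_pos (by positivity) this
  have hA : Tendsto (fun n : ℕ => c / s * Real.sqrt n) atTop atTop :=
    hsqrt.const_mul_atTop (by positivity)
  have hG := (tendsto_mul_logGen.comp hd).eventually_const_le
    (u := (1 - η ^ 2 / 16) * (Real.pi ^ 2 / 6)) (by
      have : 0 < Real.pi ^ 2 / 6 := by positivity
      nlinarith [pow_pos hη0 2])
  have hlog : ∀ᶠ n : ℕ in atTop, Real.log (2 * ((n : ℝ) + 1)) ≤ η * (c * Real.sqrt n) := by
    have h1 : (fun x : ℝ => Real.log x) =o[atTop] fun x : ℝ => x ^ (1 / 2 : ℝ) :=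
      isLittleO_log_rpow_atTop (by norm_num)
    have h2 := (h1.bound (c := η * c / 2) (by positivity))
    have h3 : Tendsto (fun n : ℕ => 2 * ((n : ℝ) + 1)) atTop atTop :=
      (tendsto_atTop_add_const_right _ _ tendsto_natCast_atTop_atTop).const_mul_atTop (by norm_num)
    filter_upwards [h3.eventually h2, eventually_ge_atTop 1] with n hn h1n
    have h1n' : (1 : ℝ) ≤ n := by exact_mod_cast h1n
    rw [← Real.sqrt_eq_rpow, Real.norm_of_nonneg (Real.sqrt_nonneg _)] at hn
    have h4 : Real.sqrt (2 * ((n : ℝ) + 1)) ≤ 2 * Real.sqrt n := by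
      rw [show 2 * Real.sqrt n = Real.sqrt (4 * n) by
        rw [Real.sqrt_mul (by norm_num), show (4 : ℝ) = 2 ^ 2 by norm_num,
          Real.sqrt_sq (by norm_num)]]
      exact Real.sqrt_le_sqrt (by linarith)
    calc _ ≤ η * c / 2 * Real.sqrt (2 * ((n : ℝ) + 1)) := (le_abs_self _).trans hn
      _ ≤ η * c / 2 * (2 * Real.sqrt n) := by gcongr
      _ = _ := by ring
  filter_upwards [hG, hlog, eventually_gt_atTop 0,
    hA.eventually_ge_atTop (Real.log 4 / (η ^ 2 / 16))] with n hGn hlogn hn hAn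
  have hr : 0 < Real.sqrt n := Real.sqrt_pos.2 (by exact_mod_cast hn)
  have hr2 : Real.sqrt n ^ 2 = n := Real.sq_sqrt (by positivity)
  have hd0 : 0 < c * s / Real.sqrt n := by positivity
  have h := log_card_partition_ge_of_logGen (n := n) (A := c / s * Real.sqrt n) hη0 hη1 hd0
    (by rw [← hc2]; field_simp)
    (by
      rw [← hs2]
      nth_rewrite 2 [← hr2]
      field_simp)
    (by
      simp only [Function.comp] at hGn
      rw [← hc2] at hGn
      have e : (1 - η ^ 2 / 16) * c ^ 2 =
        (c * s / Real.sqrt n) * ((1 - η ^ 2 / 16) * (c / s * Real.sqrt n)) := by field_simp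
      rw [e] at hGn
      exact le_of_mul_le_mul_left hGn hd0)
    (by rwa [div_le_iff₀' (by positivity)] at hAn)
  have hsi : 1 - η / 2 ≤ 1 / s := by
    rw [le_div_iff₀ hs0]
    rw [← pow_le_one_iff_of_nonneg (mul_nonneg (by linarith) hs0.le) two_ne_zero]
    rw [mul_pow, hs2]
    nlinarith [pow_pos hη0 2, pow_pos hη0 3]
  have hcr : 0 < c * Real.sqrt n := by positivity
  -- Replacing A by c√n brings the loss to 2η; the third η pays for the logarithm in `hlog`.
  have h8 : (2 - 2 * η) * (c * Real.sqrt n) ≤ (2 - η - η ^ 2 / 16) * (c / s * Real.sqrt n) := by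
    have h9 : c / s * Real.sqrt n = (c * Real.sqrt n) * (1 / s) := by ring
    have h10 := mul_le_mul_of_nonneg_left hsi
      (show 0 ≤ 2 - η - η ^ 2 / 16 by nlinarith)
    have h11 : 2 - 2 * η ≤ (2 - η - η ^ 2 / 16) * (1 - η / 2) := by
      nlinarith [pow_pos hη0 2, pow_pos hη0 3]
    rw [h9]
    have := mul_le_mul_of_nonneg_left (h11.trans h10) hcr.le
    linarith
  linarith

/-! ### Exponential moments of `X` and the bound on its mean. -/

theorem sum_map_parts {n : ℕ} (l : n.Partition) (h : ℕ → ℝ) :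
    (l.parts.map h).sum = ∑ j ∈ Finset.Icc 1 n, (mult l j : ℝ) * h j := by
  rw [Finset.sum_multiset_map_count]
  simp only [nsmul_eq_mul, mult]
  refine Finset.sum_subset (fun j hj => ?_) fun j _ hj => ?_
  · have hj := Multiset.mem_toFinset.1 hj
    exact Finset.mem_Icc.2 ⟨l.parts_pos hj, Nat.Partition.le_of_mem_parts hj⟩
  · rw [Multiset.count_eq_zero_of_notMem fun h => hj (Multiset.mem_toFinset.2 h)]
    simp

/-- Removes the case split in `X` and makes it additive over parts, so that its exponential factors
into an Euler product. -/
theorem X_eq_sum_map {n : ℕ} (s : ℝ) (l : n.Partition) :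
    X s l = (l.parts.map fun j : ℕ => if (j : ℝ) ≤ s then (j : ℝ) else 0).sum := by
  rw [X]
  split_ifs with hs
  · rw [sum_map_parts]
    simp only [mul_ite, mul_zero]
    rw [← Finset.sum_filter]
    refine Finset.sum_congr ?_ fun j _ => mul_comm _ _
    ext j
    simp only [Finset.mem_Icc, Finset.mem_filter]
    constructor
    · rintro ⟨h1, h2⟩
      have h3 : (j : ℝ) ≤ s := (Nat.le_floor_iff' (by omega)).1 h2
      exact ⟨⟨h1, by exact_mod_cast h3.trans hs⟩, h3⟩
    · rintro ⟨⟨h1, -⟩, h2⟩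
      exact ⟨h1, Nat.le_floor h2⟩
  · have h : (l.parts.map fun j : ℕ => if (j : ℝ) ≤ s then (j : ℝ) else 0) =
        l.parts.map fun j : ℕ => (j : ℝ) := by
      refine Multiset.map_congr rfl fun j hj => if_pos ?_
      have : (j : ℝ) ≤ n := by exact_mod_cast Nat.Partition.le_of_mem_parts hj
      linarith
    rw [h, ← Nat.cast_multiset_sum, l.parts_sum]

/-- The convex function -log(1 - e^{-x}) lies above its tangent at `a`. With a = (1 - θ)b this
linearizes the tilt for either sign of θ. -/
theorem neg_log_one_sub_exp_le {a b : ℝ} (ha : 0 < a) (hb : 0 < b) :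
    -Real.log (1 - Real.exp (-a)) ≤ -Real.log (1 - Real.exp (-b)) + (b - a) / (Real.exp a - 1) := by
  have h1 := exp_sub_one_pos ha
  have h2 : Real.exp (-a) < 1 := Real.exp_lt_one_iff.2 (by linarith)
  have h3 : Real.exp (-b) < 1 := Real.exp_lt_one_iff.2 (by linarith)
  have h4 := Real.log_le_sub_one_of_pos (x := (1 - Real.exp (-b)) / (1 - Real.exp (-a)))
    (div_pos (by linarith) (by linarith))
  rw [Real.log_div (by linarith) (by linarith)] at h4
  have h5 : (1 - Real.exp (-b)) / (1 - Real.exp (-a)) - 1 =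
      (1 - Real.exp (a - b)) / (Real.exp a - 1) := by
    have e1 : Real.exp (a - b) = Real.exp a * Real.exp (-b) := by rw [← Real.exp_add]; ring_nf
    have e2 : Real.exp a * Real.exp (-a) = 1 := by rw [← Real.exp_add]; simp
    have h6 : 1 - Real.exp (-a) ≠ 0 := by linarith
    rw [e1, div_sub_one h6, div_eq_div_iff h6 h1.ne']
    linear_combination (1 - Real.exp (-b)) * e2
  have h6 : (1 - Real.exp (a - b)) / (Real.exp a - 1) ≤ (b - a) / (Real.exp a - 1) := by
    have := Real.add_one_le_exp (a - b)
    exact div_le_div_of_nonneg_right (by linarith) h1.le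
  linarith

/-- A uniform bound on the exponential moments of `X s` over the partitions of `n`. -/
theorem sum_exp_X_le {d θ s : ℝ} {n : ℕ} (hd : 0 < d) (hθ : θ < 1) (hs : s ≤ n) :
    ∑ l : n.Partition, Real.exp (-d * n + θ * d * X s l) ≤
      Real.exp (logGen d + θ * ∑ i ∈ Finset.range ⌊s⌋₊,
        d * ((i : ℝ) + 1) / (Real.exp ((1 - θ) * d * ((i : ℝ) + 1)) - 1)) := by
  -- Parts up to `s` get weight e^{-(1-θ)dj}, larger ones keep e^{-dj}; the product over the parts
  -- of `l` is then exp(-dn + θ d X).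
  let h : ℕ → ℝ := fun j => -d * j + θ * d * (if (j : ℝ) ≤ s then (j : ℝ) else 0)
  have hneg : ∀ j : ℕ, 0 < j → h j < 0 := by
    intro j hj
    have hdj : 0 < d * (j : ℝ) := by positivity
    simp only [h]
    split_ifs
    · nlinarith
    · linarith
  have hterm : ∀ l : n.Partition, (l.parts.map fun j => Real.exp (h j)).prod =
      Real.exp (-d * n + θ * d * X s l) := by
    intro l
    rw [prod_map_exp, Multiset.sum_map_add, Multiset.sum_map_mul_left, Multiset.sum_map_mul_left,
      ← X_eq_sum_map, ← Nat.cast_multiset_sum, l.parts_sum]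
  have h1 : ∑ l : n.Partition, Real.exp (-d * n + θ * d * X s l) ≤
      ∏ i ∈ Finset.range n, (1 - Real.exp (h (i + 1)))⁻¹ := by
    rw [← Finset.sum_congr rfl fun l _ => hterm l]
    refine le_trans ?_ (sum_prod_parts_le (fun j => (Real.exp_pos (h j)).le)
      (fun j hj => Real.exp_lt_one_iff.2 (hneg j hj)) n)
    -- Only the summand m = n of the Euler product bound is kept.
    exact Finset.single_le_sum (f := fun m : ℕ => ∑ l : m.Partition,
      (l.parts.map fun j => Real.exp (h j)).prod) (fun m _ => Finset.sum_nonneg fun l _ =>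
      prod_map_nonneg (fun j => (Real.exp_pos (h j)).le) _) (Finset.self_mem_range_succ n)
  have h2 : ∀ i : ℕ, (1 - Real.exp (h (i + 1)))⁻¹ ≤
      Real.exp (-Real.log (1 - Real.exp (-d * ((i : ℝ) + 1))) +
        if ((i + 1 : ℕ) : ℝ) ≤ s then
          θ * (d * ((i : ℝ) + 1) / (Real.exp ((1 - θ) * d * ((i : ℝ) + 1)) - 1)) else 0) := by
    intro i
    have hlt : Real.exp (h (i + 1)) < 1 := Real.exp_lt_one_iff.2 (hneg _ i.succ_pos)
    rw [← Real.exp_log (inv_pos.2 (sub_pos.2 hlt)), Real.exp_le_exp, Real.log_inv]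
    have hdi : 0 < d * ((i : ℝ) + 1) := by positivity
    by_cases his : ((i + 1 : ℕ) : ℝ) ≤ s
    · have hθ' : 0 < 1 - θ := by linarith
      have e : h (i + 1) = -((1 - θ) * d * ((i : ℝ) + 1)) := by
        simp only [h, if_pos his]; push_cast; ring
      have hle := neg_log_one_sub_exp_le (a := (1 - θ) * d * ((i : ℝ) + 1))
        (by positivity) hdi
      rw [if_pos his, e]
      refine hle.trans (le_of_eq ?_)
      rw [neg_mul]
      ring
    · have e : h (i + 1) = -d * ((i : ℝ) + 1) := by
        simp only [h, if_neg his]; push_cast; ring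
      rw [if_neg his, e, add_zero]
  refine h1.trans ((Finset.prod_le_prod (fun i _ => inv_nonneg.2 (sub_nonneg.2
    (Real.exp_lt_one_iff.2 (hneg _ i.succ_pos)).le)) fun i _ => h2 i).trans ?_)
  rw [← Real.exp_sum, Real.exp_le_exp, Finset.sum_add_distrib]
  refine add_le_add (sum_le_hasSum _ (fun j _ => ?_) (hasSum_neg_log hd)) (le_of_eq ?_)
  · have h3 : Real.exp (-d * ((j : ℝ) + 1)) < 1 := Real.exp_lt_one_iff.2 (by
      have : 0 < d * ((j : ℝ) + 1) := by positivity
      linarith)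
    have h4 := Real.exp_pos (-d * ((j : ℝ) + 1))
    have := Real.log_nonpos (x := 1 - Real.exp (-d * ((j : ℝ) + 1))) (by linarith) (by linarith)
    linarith
  · rw [← Finset.sum_filter, Finset.mul_sum]
    refine Finset.sum_congr ?_ fun _ _ => rfl
    ext i
    simp only [Finset.mem_filter, Finset.mem_range]
    rw [← Nat.le_floor_iff' i.succ_ne_zero]
    have : ⌊s⌋₊ ≤ n := Nat.floor_le_of_le hs
    omega

/-- Jensen's inequality in tangent form: y + 1 ≤ e^y is summed over partitions, with y shifted by `B
- Real.log p` so that the exponentials add up to at most p. -/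
theorem mul_expX_le {d θ s : ℝ} {n : ℕ} (hd : 0 < d) (hθ : θ < 1) (hs : s ≤ n) :
    θ * d * expX s n ≤ d * n + logGen d + θ * ∑ i ∈ Finset.range ⌊s⌋₊,
        d * ((i : ℝ) + 1) / (Real.exp ((1 - θ) * d * ((i : ℝ) + 1)) - 1) -
      Real.log (Fintype.card n.Partition) := by
  have h := sum_exp_X_le hd hθ hs
  set B := logGen d + θ * ∑ i ∈ Finset.range ⌊s⌋₊,
        d * ((i : ℝ) + 1) / (Real.exp ((1 - θ) * d * ((i : ℝ) + 1)) - 1) with hB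
  have hp := card_partition_pos n
  set p : ℝ := ((Fintype.card n.Partition : ℕ) : ℝ) with hpdef
  have h1 : ∑ l : n.Partition, (-d * n + θ * d * X s l - (B - Real.log p) + 1) ≤ p := by
    calc _ ≤ ∑ l : n.Partition, Real.exp (-d * n + θ * d * X s l - (B - Real.log p)) :=
          Finset.sum_le_sum fun l _ => Real.add_one_le_exp _
      _ = (∑ l : n.Partition, Real.exp (-d * n + θ * d * X s l)) * Real.exp (-(B - Real.log p)) := by
          rw [Finset.sum_mul]
          exact Finset.sum_congr rfl fun l _ => by rw [← Real.exp_add]; ring_nf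
      _ ≤ Real.exp B * Real.exp (-(B - Real.log p)) := by gcongr
      _ = p := by rw [← Real.exp_add, show B + -(B - Real.log p) = Real.log p by ring,
          Real.exp_log hp]
  have h2 : ∑ l : n.Partition, (-d * n + θ * d * X s l - (B - Real.log p) + 1) =
      θ * d * (∑ l : n.Partition, X s l) + p * (-d * n - (B - Real.log p) + 1) := by
    rw [Finset.mul_sum, hpdef, ← Finset.card_univ, ← nsmul_eq_mul, ← Finset.sum_const,
      ← Finset.sum_add_distrib]
    exact Finset.sum_congr rfl fun l _ => by ring
  have h3 : (∑ l : n.Partition, X s l) = p * expX s n := by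
    rw [expX, ← hpdef]; field_simp
  rw [h2, h3] at h1
  have h4 : p * (θ * d * expX s n) ≤ p * (d * n + B - Real.log p) := by linarith
  have := le_of_mul_le_mul_left h4 hp
  linarith

/-! ### The function u/(e^u - 1) and its Riemann sums. -/

/-- The continuous extension of `u / (exp u - 1)`. -/
noncomputable def bose (u : ℝ) : ℝ := (dslope Real.exp 0 u)⁻¹

theorem bose_of_ne {u : ℝ} (hu : u ≠ 0) : bose u = u / (Real.exp u - 1) := by
  rw [bose, dslope_of_ne _ hu, slope_def_field, Real.exp_zero, sub_zero, inv_div]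

theorem bose_zero : bose 0 = 1 := by
  rw [bose, dslope_same, Real.deriv_exp, Real.exp_zero, inv_one]

theorem bose_pos (u : ℝ) : 0 < bose u := by
  rcases lt_trichotomy u 0 with hu | rfl | hu
  · rw [bose_of_ne hu.ne]
    have := Real.exp_lt_one_iff.2 hu
    exact div_pos_of_neg_of_neg hu (by linarith)
  · rw [bose_zero]; exact one_pos
  · rw [bose_of_ne hu.ne']
    exact div_pos hu (exp_sub_one_pos hu)

theorem continuous_bose : Continuous bose := by
  refine Continuous.inv₀ ?_ fun u hu => ?_
  · rw [← continuousOn_univ]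
    exact (continuousOn_dslope univ_mem).2 ⟨Real.continuous_exp.continuousOn,
      Real.differentiableAt_exp⟩
  -- If the slope vanished, its inverse would be 0 by convention, against positivity.
  · exact (bose_pos u).ne' (by rw [bose, hu, inv_zero])

theorem bose_antitoneOn : AntitoneOn bose (Set.Ici 0) := by
  intro a ha b hb hab
  have ha : 0 ≤ a := ha
  have hb : 0 ≤ b := hb
  rcases hb.eq_or_lt with rfl | hb
  · rw [le_antisymm hab ha]
  have hbe := exp_sub_one_pos hb
  rw [bose_of_ne hb.ne']
  rcases ha.eq_or_lt with rfl | ha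
  · rw [bose_zero, div_le_one hbe]
    linarith [Real.add_one_le_exp b]
  · rw [bose_of_ne ha.ne', div_le_div_iff₀ hbe (exp_sub_one_pos ha)]
    -- Convexity of exp between 0 and b: its secant slopes from 0 increase, so their inverses
    -- decrease.
    have h := convexOn_exp.2 (Set.mem_univ b) (Set.mem_univ (0 : ℝ))
      (show 0 ≤ a / b by positivity) (sub_nonneg.2 ((div_le_one hb).2 hab)) (by ring)
    have e : a / b * b = a := by field_simp
    simp only [smul_eq_mul, mul_zero, add_zero, Real.exp_zero, mul_one, e] at h
    have h2 := mul_le_mul_of_nonneg_left h hb.le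
    have e2 : b * (a / b * Real.exp b + (1 - a / b)) = a * Real.exp b + (b - a) := by field_simp
    rw [e2] at h2
    linarith

theorem integral_bose {t : ℝ} (ht : 0 < t) :
    ∫ u in (0 : ℝ)..t, bose u = ∫ u in (0 : ℝ)..t, u / (Real.exp u - 1) := by
  refine intervalIntegral.integral_congr_ae (Eventually.of_forall fun u hu => bose_of_ne ?_)
  rw [Set.uIoc_of_le ht.le] at hu
  exact hu.1.ne'

theorem integral_bose_pos {t : ℝ} (ht : 0 < t) : 0 < ∫ u in (0 : ℝ)..t, bose u :=
  intervalIntegral.intervalIntegral_pos_of_pos_on (continuous_bose.intervalIntegrable _ _)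
    (fun u _ => bose_pos u) ht

theorem continuous_integral_bose : Continuous fun t : ℝ => ∫ u in (0 : ℝ)..t, bose u :=
  intervalIntegral.continuous_primitive (fun _ _ => continuous_bose.intervalIntegrable _ _) 0

theorem integral_bose_mono {a b : ℝ} (hab : a ≤ b) :
    ∫ u in (0 : ℝ)..a, bose u ≤ ∫ u in (0 : ℝ)..b, bose u := by
  rw [← sub_nonneg, intervalIntegral.integral_interval_sub_left
    (continuous_bose.intervalIntegrable _ _) (continuous_bose.intervalIntegrable _ _)]
  exact intervalIntegral.integral_nonneg hab fun u _ => (bose_pos u).le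

theorem antitoneOn_bose_mul {e : ℝ} (he : 0 < e) {a b : ℝ} (ha : 0 ≤ a) :
    AntitoneOn (fun x => bose (e * x)) (Set.Icc a b) := by
  intro x hx y hy hxy
  exact bose_antitoneOn (mul_nonneg he.le (ha.trans hx.1)) (mul_nonneg he.le (ha.trans hy.1))
    (mul_le_mul_of_nonneg_left hxy he.le)

theorem riemannSum_bose_le {e T : ℝ} (he : 0 < e) {J : ℕ} (hJ : e * J ≤ T) :
    e * ∑ i ∈ Finset.range J, bose (e * ((i : ℝ) + 1)) ≤ ∫ u in (0 : ℝ)..T, bose u := by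
  have h := (antitoneOn_bose_mul he (a := 0) (b := 0 + J) le_rfl).sum_le_integral
  have h2 := mul_le_mul_of_nonneg_left h he.le
  rw [intervalIntegral.mul_integral_comp_mul_left] at h2
  simp only [zero_add, mul_zero, Nat.cast_add, Nat.cast_one] at h2
  exact h2.trans (integral_bose_mono hJ)

/-- A right-endpoint sum of a decreasing function dominates the integral one cell further right,
from e to e(J + 1); hence the first cell is subtracted. -/
theorem le_riemannSum_bose {e T : ℝ} (he : 0 < e) {J : ℕ} (hJ : T ≤ e * (J + 1)) :
    (∫ u in (0 : ℝ)..T, bose u) - ∫ u in (0 : ℝ)..e, bose u ≤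
      e * ∑ i ∈ Finset.range J, bose (e * ((i : ℝ) + 1)) := by
  have h := (antitoneOn_bose_mul he (a := 1) (b := 1 + J) one_pos.le).integral_le_sum
  have h2 := mul_le_mul_of_nonneg_left h he.le
  rw [intervalIntegral.mul_integral_comp_mul_left, mul_one,
    ← intervalIntegral.integral_interval_sub_left (a := 0)
    (continuous_bose.intervalIntegrable _ _) (continuous_bose.intervalIntegrable _ _)] at h2
  have h3 := integral_bose_mono hJ
  rw [add_comm (J : ℝ) 1] at h3
  have h4 : ∑ i ∈ Finset.range J, bose (e * ((i : ℝ) + 1)) =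
      ∑ i ∈ Finset.range J, bose (e * (1 + (i : ℝ))) :=
    Finset.sum_congr rfl fun i _ => by rw [add_comm]
  rw [h4]
  linarith

theorem tendsto_riemannSum_bose {c t : ℝ} (hc : 0 < c) (ht : 0 < t) :
    Tendsto (fun d => d * ∑ i ∈ Finset.range ⌊t / d⌋₊, bose (c * d * ((i : ℝ) + 1))) (𝓝[>] 0)
      (𝓝 (c⁻¹ * ∫ u in (0 : ℝ)..c * t, bose u)) := by
  have hlow : Tendsto (fun d : ℝ => c⁻¹ * ((∫ u in (0 : ℝ)..c * t, bose u) -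
      ∫ u in (0 : ℝ)..c * d, bose u)) (𝓝[>] 0) (𝓝 (c⁻¹ * ∫ u in (0 : ℝ)..c * t, bose u)) := by
    have h : Continuous fun d : ℝ => c⁻¹ * ((∫ u in (0 : ℝ)..c * t, bose u) -
        ∫ u in (0 : ℝ)..c * d, bose u) :=
      (continuous_const.sub (continuous_integral_bose.comp (continuous_const_mul c))).const_mul _
    have h2 := (h.tendsto 0).mono_left (nhdsWithin_le_nhds (s := Set.Ioi 0))
    simpa using h2
  refine tendsto_of_tendsto_of_tendsto_of_le_of_le' hlow tendsto_const_nhds ?_ ?_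
  · filter_upwards [self_mem_nhdsWithin] with d hd
    have hd : 0 < d := hd
    have h := le_riemannSum_bose (e := c * d) (T := c * t) (J := ⌊t / d⌋₊) (by positivity) (by
      have := (Nat.lt_floor_add_one (t / d)).le
      rw [div_le_iff₀ hd] at this
      rw [mul_assoc]
      gcongr
      linarith)
    rw [inv_mul_le_iff₀ hc]
    linarith
  · filter_upwards [self_mem_nhdsWithin] with d hd
    have hd : 0 < d := hd
    have h := riemannSum_bose_le (e := c * d) (T := c * t) (J := ⌊t / d⌋₊) (by positivity) (by
      have := Nat.floor_le (a := t / d) (by positivity)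
      rw [le_div_iff₀ hd] at this
      rw [mul_assoc]
      gcongr
      linarith)
    rw [le_inv_mul_iff₀ hc]
    linarith

/-! ### The limit of the normalized expectation. -/

/-- The one-sided bounds on the normalized expectation given by an exponential tilt `θ`. -/
theorem eventually_mul_expX_div_le {θ t : ℝ} (hθ0 : θ ≠ 0) (hθ1 : |θ| < 1) (ht : 0 < t) :
    ∀ᶠ n : ℕ in atTop, θ * (expX (t * Real.sqrt (6 * (n : ℝ)) / Real.pi) n / n) ≤
      4 * θ ^ 2 + θ * (6 / Real.pi ^ 2 * ((1 - θ)⁻¹ ^ 2 * ∫ u in (0 : ℝ)..(1 - θ) * t, bose u)) := by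
  obtain ⟨hθl, hθr⟩ := abs_lt.1 hθ1
  have hc : 0 < 1 - θ := by linarith
  have hsq0 : 0 < θ ^ 2 := by positivity
  have hsq1 : θ ^ 2 < 1 := by rw [sq_lt_one_iff_abs_lt_one]; exact hθ1
  have hsqrt : Tendsto (fun n : ℕ => Real.sqrt (6 * (n : ℝ))) atTop atTop :=
    Real.tendsto_sqrt_atTop.comp
      (tendsto_natCast_atTop_atTop.const_mul_atTop (by norm_num))
  have hd : Tendsto (fun n : ℕ => Real.pi / Real.sqrt (6 * (n : ℝ))) atTop (𝓝[>] 0) := by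
    refine tendsto_nhdsWithin_iff.2 ⟨hsqrt.const_div_atTop _, ?_⟩
    filter_upwards [eventually_gt_atTop 0] with n hn
    have : 0 < Real.sqrt (6 * (n : ℝ)) := Real.sqrt_pos.2 (by positivity)
    exact div_pos Real.pi_pos this
  have hR := ((tendsto_riemannSum_bose hc ht).comp hd).const_mul
    (6 / Real.pi ^ 2 * (1 - θ)⁻¹)
  have hRe : ∀ᶠ n : ℕ in atTop, θ * (6 / Real.pi ^ 2 * (1 - θ)⁻¹ *
      (Real.pi / Real.sqrt (6 * (n : ℝ)) * ∑ i ∈ Finset.range ⌊t / (Real.pi / Real.sqrt (6 * (n : ℝ)))⌋₊,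
        bose ((1 - θ) * (Real.pi / Real.sqrt (6 * (n : ℝ))) * ((i : ℝ) + 1)))) ≤
      θ ^ 2 + θ * (6 / Real.pi ^ 2 * ((1 - θ)⁻¹ ^ 2 * ∫ u in (0 : ℝ)..(1 - θ) * t, bose u)) := by
    refine (hR.const_mul θ).eventually_le_const ?_
    have : θ * (6 / Real.pi ^ 2 * (1 - θ)⁻¹ * ((1 - θ)⁻¹ * ∫ u in (0 : ℝ)..(1 - θ) * t, bose u)) =
      θ * (6 / Real.pi ^ 2 * ((1 - θ)⁻¹ ^ 2 * ∫ u in (0 : ℝ)..(1 - θ) * t, bose u)) := by ring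
    linarith
  -- The entropy bound with η = θ² costs 3θ², and `hRe` spends one more θ². The last condition
  -- amounts to `s ≤ n`.
  filter_upwards [hRe, eventually_log_card_partition_ge hsq0 hsq1, eventually_gt_atTop 0,
    hsqrt.eventually_ge_atTop (6 * t / Real.pi)] with n hRn hlog hn hbig
  have hn' : (0 : ℝ) < n := by exact_mod_cast hn
  have hr : 0 < Real.sqrt (6 * (n : ℝ)) := Real.sqrt_pos.2 (by positivity)
  have hr2 : Real.sqrt (6 * (n : ℝ)) ^ 2 = 6 * n := Real.sq_sqrt (by positivity)
  set r := Real.sqrt (6 * (n : ℝ)) with hrdef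
  have hdpos : 0 < Real.pi / r := by positivity
  have hn6 : (n : ℝ) = r ^ 2 / 6 := by linarith
  have hs : t * r / Real.pi ≤ n := by
    rw [div_le_iff₀ Real.pi_pos] at hbig ⊢
    rw [hn6]
    nlinarith
  have h := mul_expX_le hdpos hθr hs
  have hA : Real.pi / Real.sqrt 6 * Real.sqrt n = Real.pi / r * n := by
    have h6 : 0 < Real.sqrt 6 := by positivity
    have hsn : 0 < Real.sqrt n := Real.sqrt_pos.2 hn'
    rw [hrdef, Real.sqrt_mul (by norm_num)]
    nth_rewrite 3 [← Real.sq_sqrt hn'.le]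
    field_simp
  rw [hA] at hlog
  have hG := logGen_le hdpos
  have hG2 : Real.pi ^ 2 / 6 / (Real.pi / r) = Real.pi / r * n := by
    rw [hn6]; field_simp
  rw [hG2] at hG
  have hsum : ∑ i ∈ Finset.range ⌊t * r / Real.pi⌋₊, Real.pi / r * ((i : ℝ) + 1) /
      (Real.exp ((1 - θ) * (Real.pi / r) * ((i : ℝ) + 1)) - 1) =
      (Real.pi / r * n) * (6 / Real.pi ^ 2 * (1 - θ)⁻¹ * (Real.pi / r *
        ∑ i ∈ Finset.range ⌊t / (Real.pi / r)⌋₊, bose ((1 - θ) * (Real.pi / r) * ((i : ℝ) + 1)))) := by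
    rw [show t / (Real.pi / r) = t * r / Real.pi by field_simp, Finset.mul_sum, Finset.mul_sum,
      Finset.mul_sum]
    refine Finset.sum_congr rfl fun i _ => ?_
    have hu : 0 < (1 - θ) * (Real.pi / r) * ((i : ℝ) + 1) := by positivity
    have he := exp_sub_one_pos hu
    rw [bose_of_ne hu.ne', hn6]
    field_simp
  rw [hsum] at h
  set R := 6 / Real.pi ^ 2 * (1 - θ)⁻¹ * (Real.pi / r *
        ∑ i ∈ Finset.range ⌊t / (Real.pi / r)⌋₊, bose ((1 - θ) * (Real.pi / r) * ((i : ℝ) + 1)))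
  have hfin : (Real.pi / r * n) * (θ * (expX (t * r / Real.pi) n / n)) ≤
      (Real.pi / r * n) * (3 * θ ^ 2 + θ * R) := by
    have e : (Real.pi / r * n) * (θ * (expX (t * r / Real.pi) n / n)) =
      θ * (Real.pi / r) * expX (t * r / Real.pi) n := by field_simp
    rw [e]
    linarith
  have := le_of_mul_le_mul_left hfin (by positivity)
  linarith

theorem tendsto_expX_div {t : ℝ} (ht : 0 < t) :
    Tendsto (fun n : ℕ => expX (t * Real.sqrt (6 * (n : ℝ)) / Real.pi) n / n) atTop
      (𝓝 (6 / Real.pi ^ 2 * ∫ u in (0 : ℝ)..t, bose u)) := by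
  let g : ℝ → ℝ := fun θ =>
    4 * θ + 6 / Real.pi ^ 2 * ((1 - θ)⁻¹ ^ 2 * ∫ u in (0 : ℝ)..(1 - θ) * t, bose u)
  have hg : Tendsto g (𝓝 0) (𝓝 (6 / Real.pi ^ 2 * ∫ u in (0 : ℝ)..t, bose u)) := by
    have h1 : ContinuousAt g 0 := by
      have hI : Continuous fun θ : ℝ => ∫ u in (0 : ℝ)..(1 - θ) * t, bose u :=
        continuous_integral_bose.comp (by fun_prop)
      have hinv : ContinuousAt (fun θ : ℝ => (1 - θ)⁻¹) 0 :=
        ContinuousAt.inv₀ (by fun_prop) (by norm_num)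
      exact (continuousAt_id.const_mul 4).add (((hinv.pow 2).mul hI.continuousAt).const_mul _)
    have h2 : g 0 = 6 / Real.pi ^ 2 * ∫ u in (0 : ℝ)..t, bose u := by simp [g]
    rw [← h2]
    exact h1
  have hsmall : ∀ᶠ θ : ℝ in 𝓝 0, |θ| < 1 := by
    have : Tendsto (fun θ : ℝ => |θ|) (𝓝 0) (𝓝 0) := by
      simpa using (continuous_abs.tendsto (0 : ℝ))
    exact this.eventually_lt_const one_pos
  have hbound : ∀ {θ : ℝ}, θ ≠ 0 → |θ| < 1 → ∀ᶠ n : ℕ in atTop,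
      θ * (expX (t * Real.sqrt (6 * (n : ℝ)) / Real.pi) n / n) ≤ θ * g θ := by
    intro θ h0 h1
    filter_upwards [eventually_mul_expX_div_le h0 h1 ht] with n hn
    refine hn.trans (le_of_eq ?_)
    simp only [g]
    ring
  -- Dividing `hbound` by a negative θ gives the lower estimate, by a positive θ the upper one; θ
  -- near 0 is chosen by continuity of `g`.
  refine tendsto_order.2 ⟨fun a ha => ?_, fun a ha => ?_⟩
  · obtain ⟨θ, ⟨hθ, h1⟩, hneg⟩ := ((((hg.eventually_const_lt ha).and hsmall).filter_mono
      (nhdsWithin_le_nhds (s := Set.Iio 0))).and self_mem_nhdsWithin).exists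
    have hneg : θ < 0 := hneg
    filter_upwards [hbound hneg.ne h1] with n hn
    exact hθ.trans_le ((mul_le_mul_left_of_neg hneg).1 hn)
  · obtain ⟨θ, ⟨hθ, h1⟩, hpos⟩ := ((((hg.eventually_lt_const ha).and hsmall).filter_mono
      (nhdsWithin_le_nhds (s := Set.Ioi 0))).and self_mem_nhdsWithin).exists
    have hpos : 0 < θ := hpos
    filter_upwards [hbound hpos.ne' h1] with n hn
    exact (le_of_mul_le_mul_left hn hpos).trans_lt hθ

/-! ### From the two-step procedure to the expectation. -/

theorem toMeasure_pickPart {n : ℕ} (hn : 0 < n) (l : n.Partition) (s : ℝ) :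
    ((pickPart hn l).toMeasure {j : ℕ | (j : ℝ) ≤ s}).toReal = X s l / n := by
  classical
  rw [PMF.toMeasure_apply _ (MeasurableSet.of_discrete),
    tsum_eq_sum (s := Finset.Icc 1 n), ENNReal.toReal_sum, X_eq_sum_map, sum_map_parts,
    Finset.sum_div]
  · refine Finset.sum_congr rfl fun j _ => ?_
    by_cases hj : (j : ℝ) ≤ s
    · rw [Set.indicator_of_mem (by exact hj), pickPart, PMF.normalize_apply, tsum_weight,
        if_pos hj, weight, ENNReal.toReal_mul, ENNReal.toReal_inv, ENNReal.toReal_natCast,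
        ENNReal.toReal_natCast, div_eq_mul_inv]
      push_cast
      ring
    · rw [Set.indicator_of_notMem (by exact hj), if_neg hj]
      simp
  · intro j _
    by_cases hj : (j : ℝ) ≤ s
    · rw [Set.indicator_of_mem (by exact hj)]
      exact PMF.apply_ne_top _ _
    · rw [Set.indicator_of_notMem (by exact hj)]
      exact ENNReal.zero_ne_top
  · intro j hj
    refine Set.indicator_apply_eq_zero.2 fun _ => ?_
    have hw : weight l j = 0 := by
      rw [weight, mult, Multiset.count_eq_zero_of_notMem, mul_zero]
      exact fun h => hj (Finset.mem_Icc.2 ⟨l.parts_pos h, Nat.Partition.le_of_mem_parts h⟩)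
    rw [pickPart, PMF.normalize_apply, hw, Nat.cast_zero, zero_mul]

theorem sizeLaw_eq_bind {n : ℕ} (hn : 0 < n) :
    sizeLaw hn = (PMF.uniformOfFintype n.Partition).bind (pickPart hn) := by
  rw [sizeLaw, procedure, PMF.map_bind]
  congr 1
  funext l
  rw [PMF.map_comp]
  exact PMF.map_id _

/-- The distribution function of the size of the picked part. -/
theorem sizeLaw_real_le {n : ℕ} (hn : 0 < n) (s : ℝ) :
    (sizeLaw hn).toMeasure.real {j : ℕ | (j : ℝ) ≤ s} = expX s n / n := by
  rw [MeasureTheory.measureReal_def, sizeLaw_eq_bind,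
    PMF.toMeasure_bind_apply _ _ _ (MeasurableSet.of_discrete), tsum_fintype,
    ENNReal.toReal_sum, expX, div_div, Finset.sum_div]
  · refine Finset.sum_congr rfl fun l _ => ?_
    rw [ENNReal.toReal_mul, toMeasure_pickPart, PMF.uniformOfFintype_apply, ENNReal.toReal_inv,
      ENNReal.toReal_natCast, ← div_eq_inv_mul, div_div, mul_comm]
  · intro l _
    exact ENNReal.mul_ne_top (PMF.apply_ne_top _ _) (MeasureTheory.measure_ne_top _ _)

end PartSampling

theorem theorem3 (t : ℝ) (ht : 0 < t) :
    Filter.Tendsto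
      (fun n : ℕ+ => (PartSampling.sizeLaw n.pos).toMeasure.real
        {j : ℕ | Real.pi * (j : ℝ) / Real.sqrt (6 * (n : ℝ)) ≤ t})
      Filter.atTop
      (nhds (6 / Real.pi ^ 2 * ∫ u in (0 : ℝ)..t, u / (Real.exp u - 1))) ∧
    Asymptotics.IsEquivalent Filter.atTop
      (fun n : ℕ+ => PartSampling.expX (t * Real.sqrt (6 * (n : ℝ)) / Real.pi) (n : ℕ))
      (fun n : ℕ+ => 6 * (n : ℝ) / Real.pi ^ 2 *
        ∫ u in (0 : ℝ)..t, u / (Real.exp u - 1)) := by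
  have hlim := (PartSampling.tendsto_expX_div ht).comp tendsto_PNat_val_atTop_atTop
  have hpos := PartSampling.integral_bose_pos ht
  rw [PartSampling.integral_bose ht] at hlim hpos
  refine ⟨hlim.congr fun n => ?_, Asymptotics.isEquivalent_of_tendsto_one ?_⟩
  · have hn : (0 : ℝ) < (n : ℕ) := by exact_mod_cast n.pos
    have hr : 0 < Real.sqrt (6 * ((n : ℕ) : ℝ)) := Real.sqrt_pos.2 (by positivity)
    have hset : {j : ℕ | Real.pi * (j : ℝ) / Real.sqrt (6 * ((n : ℕ) : ℝ)) ≤ t} =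
        {j : ℕ | (j : ℝ) ≤ t * Real.sqrt (6 * ((n : ℕ) : ℝ)) / Real.pi} := by
      ext j
      rw [Set.mem_ofPred_eq, Set.mem_ofPred_eq, div_le_iff₀ hr, le_div_iff₀' Real.pi_pos]
    rw [hset, PartSampling.sizeLaw_real_le]
    rfl
  · set L := ∫ u in (0 : ℝ)..t, u / (Real.exp u - 1)
    have hL : 6 / Real.pi ^ 2 * L ≠ 0 := by positivity
    have h := hlim.div_const (6 / Real.pi ^ 2 * L)
    rw [div_self hL] at h
    refine h.congr fun n => ?_
    have hn : (0 : ℝ) < (n : ℕ) := by exact_mod_cast n.pos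
    simp only [Function.comp, Pi.div_apply]
    field_simp
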